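/- Consider a closed metro line cut into $n$ segments, with nodes and segments numbered modulo $n$, segment $j$ going from node $j-1$ to node $j$. Let $b_j\in\{0,1\}$ be the number of trains on segment $j$ at time zero, $\bar b_j=1-b_j$, and $m=\sum_j b_j$ the number of trains. Let some of the nodes be platforms, let $r_j$, $\underline w_j$, $\overline w_j$, $\underline g_j$ be real constants (running time, minimum and maximum dwell time, minimum safe separation time), $\underline s_j=\underline g_j-r_j$, and let $\delta_j$ be time-independent control parameters. The departure times $d_j^k$ ($k\ge 0$) satisfy, for $k\ge 1$ and $j$ a platform, $$d_j^k=\max\Big\{d_{j-1}^{k-b_j}+r_j+\underline w_j,\ (1-\delta_j)\,d_{j-1}^{k-b_j}+\delta_j\,d_j^{k-1}+(1-\delta_j)r_j+\overline w_j,\ d_{j+1}^{k-\bar b_{j+1}}+\underline s_{j+1}\Big\},$$ and, for $k\ge1$ and $j$ not a platform, $$d_j^k=\max\Big\{d_{j-1}^{k-b_j}+r_j+\underline w_j,\ d_{j+1}^{k-\bar b_{j+1}}+\underline s_{j+1}\Big\}.$$ Write this system as $d^k=\mathbf f(d^k,d^{k-1})$. Suppose that $0<m<n$ and that $0\le\delta_j\le1$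 for all platforms $j$. Then every initial state $d^0\in\mathbb R^n$ determines exactly one solution $(d^k)_{k\ge0}$, and there is a real number $h$ such that: 1. the system has a stationary regime with additive eigenvalue $h$: there is $v\in\mathbb R^n$ with $\mathbf f(v,\,v-h\mathbf 1)=v$, so that $d^k=v+kh\mathbf 1$ is a solution; 2. $h$ is the only additive eigenvalue: if $\mu\in\mathbb R$, $v\in\mathbb R^n$ and $\mathbf f(v,\,v-\mu\mathbf 1)=v$, then $\mu=h$; 3. for every initial state $d^0$, the asymptotic average growth vector $\lim_{k\to\infty}d^k/k$ exists and all its components are equal to $h$. -/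

import Mathlib

open Filter Topology

/-- Data of a closed metro line cut into `n` segments; nodes and segments are numbered modulo `n`,
and segment `j` goes from node `j - 1` to node `j`. -/
structure MetroLine (n : ℕ) where
  /-- `b j` says whether a train stands on segment `j` at time zero (`b_j ∈ {0, 1}`). -/
  b : ZMod n → Bool
  /-- the nodes that are platforms -/
  platform : Finset (ZMod n)
  /-- running time `r_j` on segment `j` -/
  r : ZMod n → ℝ
  /-- minimum dwell time at node `j` -/
  wMin : ZMod n → ℝ
  /-- maximum dwell time (control parameter) at node `j`, used only at platforms -/
  wMax : ZMod n → ℝ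
  /-- minimum safe separation time at node `j` -/
  gMin : ZMod n → ℝ
  /-- time-independent control parameter `δ_j`, used only at platforms -/
  δ : ZMod n → ℝ

namespace MetroLine

variable {n : ℕ}

/-- The number `m = ∑ j, b_j` of running trains. -/
def numTrains [NeZero n] (L : MetroLine n) : ℕ := ∑ j, if L.b j then 1 else 0

/-- Minimum travel time from node `j - 1` to node `j`. -/
def tMin (L : MetroLine n) (j : ZMod n) : ℝ := L.r j + L.wMin j

/-- Minimum safe separation time at node `j`, running time not counted. -/
def sMin (L : MetroLine n) (j : ZMod n) : ℝ := L.gMin j - L.r j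

/-- With `x = d^k` and `y = d^(k-1)`, the departure time `d_(j-1)^(k - b_j)`. -/
def upstream (L : MetroLine n) (x y : ZMod n → ℝ) (j : ZMod n) : ℝ :=
  if L.b j then y (j - 1) else x (j - 1)

/-- With `x = d^k` and `y = d^(k-1)`, the departure time `d_(j+1)^(k - (1 - b_(j+1)))`. -/
def downstream (L : MetroLine n) (x y : ZMod n → ℝ) (j : ZMod n) : ℝ :=
  if L.b (j + 1) then x (j + 1) else y (j + 1)

/-- The map `f` of the controlled train dynamics `d^k = f(d^k, d^(k-1))`. At platforms there are
three terms; at the other nodes the middle one (the dwell time control) is absent. -/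
noncomputable def f (L : MetroLine n) (x y : ZMod n → ℝ) (j : ZMod n) : ℝ :=
  if j ∈ L.platform then
    max (L.upstream x y j + L.r j + L.wMin j)
      (max ((1 - L.δ j) * L.upstream x y j + L.δ j * y j + (1 - L.δ j) * L.r j + L.wMax j)
        (L.downstream x y j + L.sMin (j + 1)))
  else
    max (L.upstream x y j + L.tMin j) (L.downstream x y j + L.sMin (j + 1))

/-- `d` solves the controlled train dynamics: `d^k = f(d^k, d^(k-1))` for all `k ≥ 1`. -/
def IsTrajectory (L : MetroLine n) (d : ℕ → ZMod n → ℝ) : Prop :=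
  ∀ k : ℕ, d (k + 1) = L.f (d (k + 1)) (d k)

/-- `v` is a (finite) additive eigenvector of the dynamics for the generalized additive
eigenvalue `μ`: `f(v, v - μ) = v`. -/
def IsEigenpair (L : MetroLine n) (μ : ℝ) (v : ZMod n → ℝ) : Prop :=
  L.f v (fun j => v j - μ) = v

/-- `μ` is a generalized additive eigenvalue of the dynamics. -/
def IsEigenvalue (L : MetroLine n) (μ : ℝ) : Prop := ∃ v, L.IsEigenpair μ v

end MetroLine

/-- `χ = lim_{k → ∞} d^k / k` exists and is the asymptotic average growth vector of `d`. -/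
def HasGrowthVector {n : ℕ} (d : ℕ → ZMod n → ℝ) (χ : ZMod n → ℝ) : Prop :=
  Tendsto (fun k : ℕ => (k : ℝ)⁻¹ • d k) atTop (𝓝 χ)

namespace MetroLine

variable {n : ℕ}

/-- A rank of the nodes that increases strictly along the instantaneous dependencies of the
dynamics: downstream across empty segments, upstream across occupied ones. -/
def IsRank (L : MetroLine n) (ρ : ZMod n → ℕ) : Prop :=
  ∀ j, (L.b j = false → ρ (j - 1) < ρ j) ∧ (L.b (j + 1) = true → ρ (j + 1) < ρ j)

/-- With at least one train and at least one free segment, the instantaneous dependencies are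
acyclic. -/
theorem exists_isRank [NeZero n] (L : MetroLine n) (h1 : ∃ j, L.b j = true)
    (h0 : ∃ j, L.b j = false) : ∃ ρ, L.IsRank ρ := by
  classical
  have hl : ∀ j : ZMod n, ∃ k : ℕ, L.b (j - k) = true := fun j => by
    obtain ⟨i, hi⟩ := h1
    exact ⟨(j - i).val, by simpa using hi⟩
  have hr : ∀ j : ZMod n, ∃ k : ℕ, L.b (j + 1 + k) = false := fun j => by
    obtain ⟨i, hi⟩ := h0
    exact ⟨(i - (j + 1)).val, by simpa using hi⟩
  refine ⟨fun j => Nat.find (hl j) + Nat.find (hr j), fun j => ⟨fun hj => ?_, fun hj => ?_⟩⟩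
  · have e1 : Nat.find (hr (j - 1)) = 0 := by
      rw [Nat.find_eq_zero]; simpa using hj
    have e2 : Nat.find (hl j) = Nat.find (hl (j - 1)) + 1 := by
      rw [Nat.find_comp_succ (hl j) (h₂ := by
        obtain ⟨k, hk⟩ := hl (j - 1)
        exact ⟨k, by rw [← hk]; congr 1; push_cast; ring⟩) (by simp [hj])]
      congr 1
      apply Nat.find_congr'
      intro k
      rw [show j - ((k + 1 : ℕ) : ZMod n) = j - 1 - k by push_cast; ring]
    simp only [e1, e2]
    omega
  · have e1 : Nat.find (hl (j + 1)) = 0 := by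
      rw [Nat.find_eq_zero]; simpa using hj
    have e2 : Nat.find (hr j) = Nat.find (hr (j + 1)) + 1 := by
      rw [Nat.find_comp_succ (hr j) (h₂ := by
        obtain ⟨k, hk⟩ := hr (j + 1)
        exact ⟨k, by rw [← hk]; congr 1; push_cast; ring⟩) (by simp [hj])]
      congr 1
      apply Nat.find_congr'
      intro k
      rw [show j + 1 + ((k + 1 : ℕ) : ZMod n) = j + 1 + 1 + k by push_cast; ring]
    simp only [e1, e2]
    omega

theorem exists_train_and_free [NeZero n] (L : MetroLine n)
    (hm : 0 < L.numTrains ∧ L.numTrains < n) :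
    (∃ j, L.b j = true) ∧ ∃ j, L.b j = false := by
  obtain ⟨h0, h1⟩ := hm
  constructor
  · by_contra! h
    simp [numTrains, h] at h0
  · by_contra! h
    simp [numTrains, h, ZMod.card] at h1

theorem f_mono_at (L : MetroLine n) (hδ : ∀ j ∈ L.platform, 0 ≤ L.δ j ∧ L.δ j ≤ 1)
    {x y x' y' : ZMod n → ℝ} {c : ℝ} {j : ZMod n} (hy : y j ≤ y' j + c)
    (hu : L.upstream x y j ≤ L.upstream x' y' j + c)
    (hd : L.downstream x y j ≤ L.downstream x' y' j + c) :
    L.f x y j ≤ L.f x' y' j + c := by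
  unfold f
  split_ifs with hj
  · obtain ⟨h0, h1⟩ := hδ j hj
    have a1 := mul_le_mul_of_nonneg_left hy h0
    have a2 := mul_le_mul_of_nonneg_left hu (sub_nonneg.2 h1)
    rw [← max_add_add_right, ← max_add_add_right]
    exact max_le_max (by linarith) (max_le_max (by linarith) (by linarith))
  · rw [← max_add_add_right]
    exact max_le_max (by linarith) (by linarith)

/-- Comparison principle for the implicit dynamics. -/
theorem le_add_of_eq_f (L : MetroLine n) {ρ : ZMod n → ℕ} (hρ : L.IsRank ρ)
    (hδ : ∀ j ∈ L.platform, 0 ≤ L.δ j ∧ L.δ j ≤ 1) {x y x' y' : ZMod n → ℝ} {c : ℝ}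
    (hx : x = L.f x y) (hx' : x' = L.f x' y') (hy : ∀ j, y j ≤ y' j + c) (j : ZMod n) :
    x j ≤ x' j + c := by
  induction hk : ρ j using Nat.strong_induction_on generalizing j with
  | _ k ih =>
    subst hk
    rw [hx, hx']
    refine L.f_mono_at hδ (hy j) ?_ ?_
    · unfold upstream
      split_ifs with hb
      · exact hy _
      · exact ih _ ((hρ j).1 (by simpa using hb)) _ rfl
    · unfold downstream
      split_ifs with hb
      · exact ih _ ((hρ j).2 hb) _ rfl
      · exact hy _

theorem eq_of_eq_f (L : MetroLine n) {ρ : ZMod n → ℕ} (hρ : L.IsRank ρ)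
    (hδ : ∀ j ∈ L.platform, 0 ≤ L.δ j ∧ L.δ j ≤ 1) {x x' y : ZMod n → ℝ}
    (hx : x = L.f x y) (hx' : x' = L.f x' y) : x = x' := by
  funext j
  have h1 := L.le_add_of_eq_f hρ hδ (c := 0) hx hx' (by simp) j
  have h2 := L.le_add_of_eq_f hρ hδ (c := 0) hx' hx (by simp) j
  linarith

theorem norm_sub_le_of_eq_f [NeZero n] (L : MetroLine n) {ρ : ZMod n → ℕ} (hρ : L.IsRank ρ)
    (hδ : ∀ j ∈ L.platform, 0 ≤ L.δ j ∧ L.δ j ≤ 1) {x y x' y' : ZMod n → ℝ}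
    (hx : x = L.f x y) (hx' : x' = L.f x' y') : ‖x - x'‖ ≤ ‖y - y'‖ := by
  rw [pi_norm_le_iff_of_nonneg (norm_nonneg _)]
  intro j
  have hb : ∀ i, |y i - y' i| ≤ ‖y - y'‖ := fun i => norm_le_pi_norm (y - y') i
  have h1 := L.le_add_of_eq_f hρ hδ (c := ‖y - y'‖) hx hx'
    (fun i => by linarith [(abs_le.1 (hb i)).2]) j
  have h2 := L.le_add_of_eq_f hρ hδ (c := ‖y - y'‖) hx' hx
    (fun i => by linarith [(abs_le.1 (hb i)).1]) j
  rw [Pi.sub_apply, Real.norm_eq_abs, abs_le]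
  constructor <;> linarith

theorem exists_eq_f [NeZero n] (L : MetroLine n) {ρ : ZMod n → ℕ} (hρ : L.IsRank ρ)
    (y : ZMod n → ℝ) : ∃ x, x = L.f x y := by
  let F : (ZMod n → ℝ) → ZMod n → ℝ := fun x => L.f x y
  have key : ∀ k : ℕ, ∀ j, ρ j < k → F^[k + 1] 0 j = F^[k] 0 j := by
    intro k
    induction k with
    | zero => intro j hj; omega
    | succ k ih =>
      intro j hj
      have hu : L.upstream (F^[k + 1] 0) y j = L.upstream (F^[k] 0) y j := by
        unfold upstream
        split_ifs with hb
        · rfl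
        · exact ih _ (by have := (hρ j).1 (by simpa using hb); omega)
      have hd : L.downstream (F^[k + 1] 0) y j = L.downstream (F^[k] 0) y j := by
        unfold downstream
        split_ifs with hb
        · exact ih _ (by have := (hρ j).2 hb; omega)
        · rfl
      rw [Function.iterate_succ_apply' F (k + 1)]
      conv_rhs => rw [Function.iterate_succ_apply' F k]
      change L.f (F^[k + 1] 0) y j = L.f (F^[k] 0) y j
      unfold f
      rw [hu, hd]
  refine ⟨F^[Finset.univ.sup ρ + 1] 0, funext fun j => ?_⟩
  rw [← key _ j (Nat.lt_succ_of_le (Finset.le_sup (Finset.mem_univ j))),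
    Function.iterate_succ_apply']

theorem f_add_const (L : MetroLine n) (x y : ZMod n → ℝ) (c : ℝ) :
    L.f (fun j => x j + c) (fun j => y j + c) = fun j => L.f x y j + c := by
  funext j
  have hu : L.upstream (fun j => x j + c) (fun j => y j + c) j = L.upstream x y j + c := by
    unfold upstream; split_ifs <;> rfl
  have hd : L.downstream (fun j => x j + c) (fun j => y j + c) j = L.downstream x y j + c := by
    unfold downstream; split_ifs <;> rfl
  unfold f
  rw [hu, hd]
  split_ifs
  · rw [← max_add_add_right, ← max_add_add_right]
    congr 1
    · ring
    · congr 1 <;> ring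
  · rw [← max_add_add_right]
    congr 1 <;> ring

theorem continuous_f (L : MetroLine n) :
    Continuous fun p : (ZMod n → ℝ) × (ZMod n → ℝ) => L.f p.1 p.2 := by
  refine continuous_pi fun j => ?_
  have hu : Continuous fun p : (ZMod n → ℝ) × (ZMod n → ℝ) => L.upstream p.1 p.2 j := by
    unfold upstream; split_ifs <;> fun_prop
  have hd : Continuous fun p : (ZMod n → ℝ) × (ZMod n → ℝ) => L.downstream p.1 p.2 j := by
    unfold downstream; split_ifs <;> fun_prop
  unfold f
  split_ifs <;> fun_prop

theorem upstream_add_tMin_le_f (L : MetroLine n) (x y : ZMod n → ℝ) (j : ZMod n) :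
    L.upstream x y j + L.tMin j ≤ L.f x y j := by
  unfold f tMin
  split_ifs
  · rw [← add_assoc]; exact le_max_left _ _
  · exact le_max_left _ _

/-- A function on the cycle whose decrease from each node to the next is at most `C` has oscillation
at most `n * C`. -/
theorem sub_le_of_step [NeZero n] {x : ZMod n → ℝ} {C : ℝ} (hC : 0 ≤ C)
    (h : ∀ j, x (j - 1) - x j ≤ C) (i j : ZMod n) : x i - x j ≤ n * C := by
  have hk : ∀ k : ℕ, x i - x (i + k) ≤ k * C := by
    intro k
    induction k with
    | zero => simp
    | succ k ih =>
      have := h (i + (k + 1 : ℕ))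
      rw [show i + ((k + 1 : ℕ) : ZMod n) - 1 = i + k by push_cast; ring] at this
      push_cast at this ⊢
      linarith
  have h1 := hk (j - i).val
  rw [ZMod.natCast_zmod_val, add_sub_cancel] at h1
  have h2 : ((j - i).val : ℝ) ≤ n := by exact_mod_cast (ZMod.val_lt (j - i)).le
  nlinarith

/-- Discounted stationary equation. -/
theorem exists_discounted [NeZero n] (L : MetroLine n) {ρ : ZMod n → ℕ} (hρ : L.IsRank ρ)
    (hδ : ∀ j ∈ L.platform, 0 ≤ L.δ j ∧ L.δ j ≤ 1) {a : ℝ} (ha0 : 0 ≤ a) (ha1 : a < 1) :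
    ∃ x, x = L.f x (a • x) := by
  choose g hg using L.exists_eq_f hρ
  have hc : ContractingWith ⟨a, ha0⟩ fun x => g (a • x) := by
    refine ⟨by exact_mod_cast ha1, LipschitzWith.of_dist_le_mul fun x x' => ?_⟩
    rw [dist_eq_norm, dist_eq_norm]
    refine (L.norm_sub_le_of_eq_f hρ hδ (hg _) (hg _)).trans ?_
    rw [← smul_sub, norm_smul, Real.norm_of_nonneg ha0]
    rfl
  refine ⟨hc.fixedPoint, ?_⟩
  have h := hg (a • hc.fixedPoint)
  have hf : g (a • hc.fixedPoint) = hc.fixedPoint := hc.fixedPoint_isFixedPt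
  rwa [hf] at h

/-- A priori bounds for the discounted stationary equation, uniform in the discount factor. -/
theorem exists_discounted_bounds [NeZero n] (L : MetroLine n) {ρ : ZMod n → ℕ}
    (hρ : L.IsRank ρ) (hδ : ∀ j ∈ L.platform, 0 ≤ L.δ j ∧ L.δ j ≤ 1) :
    ∃ D K : ℝ, ∀ (a : ℝ) (x : ZMod n → ℝ), 0 ≤ a → a < 1 → x = L.f x (a • x) →
      ‖(1 - a) • x‖ ≤ D ∧ ∀ i j, |x i - x j| ≤ K := by
  obtain ⟨z, hz⟩ := L.exists_eq_f hρ 0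
  refine ⟨‖z‖, n * (‖z‖ + ‖L.tMin‖), fun a x ha0 ha1 hx => ?_⟩
  have hD : ‖(1 - a) • x‖ ≤ ‖z‖ := by
    have h := L.norm_sub_le_of_eq_f hρ hδ hx hz
    rw [sub_zero, norm_smul, Real.norm_of_nonneg ha0] at h
    rw [norm_smul, Real.norm_of_nonneg (by linarith)]
    have := norm_le_norm_add_norm_sub' x z
    linarith
  refine ⟨hD, ?_⟩
  have hstep : ∀ j, x (j - 1) - x j ≤ ‖z‖ + ‖L.tMin‖ := by
    intro j
    have h1 := L.upstream_add_tMin_le_f x (a • x) j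
    rw [← hx] at h1
    have h2 : x (j - 1) - ‖z‖ ≤ L.upstream x (a • x) j := by
      unfold upstream
      split_ifs
      · have h3 := (le_abs_self _).trans ((norm_le_pi_norm ((1 - a) • x) (j - 1)).trans hD)
        simp only [Pi.smul_apply, smul_eq_mul] at h3 ⊢
        linarith
      · linarith [norm_nonneg z]
    have h4 := (neg_le_abs _).trans (norm_le_pi_norm L.tMin j)
    linarith
  have hosc := sub_le_of_step (add_nonneg (norm_nonneg z) (norm_nonneg L.tMin)) hstep
  exact fun i j => abs_sub_le_iff.2 ⟨hosc i j, hosc j i⟩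

/-- Existence of a stationary regime, by letting the discount factor tend to one. -/
theorem exists_isEigenpair [NeZero n] (L : MetroLine n) {ρ : ZMod n → ℕ} (hρ : L.IsRank ρ)
    (hδ : ∀ j ∈ L.platform, 0 ≤ L.δ j ∧ L.δ j ≤ 1) : ∃ h v, L.IsEigenpair h v := by
  obtain ⟨D, K, hDK⟩ := L.exists_discounted_bounds hρ hδ
  let a : ℕ → ℝ := fun k => 1 - 1 / ((k : ℝ) + 1)
  have ha0 : ∀ k, 0 ≤ a k := fun k => by
    have : (1 : ℝ) / (k + 1) ≤ 1 := by
      rw [div_le_one (by positivity)]; linarith [(Nat.cast_nonneg k : (0 : ℝ) ≤ k)]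
    simp only [a]; linarith
  have ha1 : ∀ k, a k < 1 := fun k => by
    have : (0 : ℝ) < 1 / (k + 1) := by positivity
    simp only [a]; linarith
  have hlim : Tendsto (fun k => 1 - a k) atTop (𝓝 0) := by
    simpa [a] using tendsto_one_div_add_atTop_nhds_zero_nat (𝕜 := ℝ)
  choose x hx using fun k => L.exists_discounted hρ hδ (ha0 k) (ha1 k)
  have hD := fun k => (hDK (a k) (x k) (ha0 k) (ha1 k) (hx k)).1
  have hK := fun k => (hDK (a k) (x k) (ha0 k) (ha1 k) (hx k)).2
  have hK0 : 0 ≤ K := (abs_nonneg _).trans (hK 0 0 0)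
  let u : ℕ → ZMod n → ℝ := fun k j => a k * x k j - a k * x k 0
  let w : ℕ → ZMod n → ℝ := fun k => (1 - a k) • x k
  have hu : ∀ k, ‖u k‖ ≤ K := fun k => by
    rw [pi_norm_le_iff_of_nonneg hK0]
    intro j
    simp only [u]
    rw [← mul_sub, norm_mul, Real.norm_of_nonneg (ha0 k)]
    exact (mul_le_of_le_one_left (norm_nonneg _) (ha1 k).le).trans (hK k j 0)
  have heq : ∀ k, L.f (u k + w k) (u k) = u k + w k := fun k => by
    have h := L.f_add_const (x k) (a k • x k) (-(a k * x k 0))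
    rw [← hx k] at h
    have e1 : (fun j => x k j + -(a k * x k 0)) = u k + w k := by
      funext j
      simp only [u, w, Pi.add_apply, Pi.smul_apply, smul_eq_mul]
      ring
    have e2 : (fun j => (a k • x k) j + -(a k * x k 0)) = u k := by
      funext j
      simp only [u, Pi.smul_apply, smul_eq_mul]
      ring
    rwa [e1, e2] at h
  obtain ⟨⟨U, W⟩, -, φ, hφ, hUW⟩ := ((isCompact_closedBall (0 : ZMod n → ℝ) K).prod
    (isCompact_closedBall (0 : ZMod n → ℝ) D)).tendsto_subseq (x := fun k => (u k, w k))
    (fun k => ⟨by simpa using hu k, by simpa using hD k⟩)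
  have hU : Tendsto (fun k => u (φ k)) atTop (𝓝 U) := (continuous_fst.tendsto _).comp hUW
  have hW : Tendsto (fun k => w (φ k)) atTop (𝓝 W) := (continuous_snd.tendsto _).comp hUW
  have hfix : L.f (U + W) U = U + W :=
    tendsto_nhds_unique
      ((L.continuous_f.tendsto (U + W, U)).comp ((hU.add hW).prodMk_nhds hU))
      ((hU.add hW).congr fun k => (heq (φ k)).symm)
  have hconst : ∀ j, W j = W 0 := fun j => by
    have h1 : Tendsto (fun k => w (φ k) j - w (φ k) 0) atTop (𝓝 (W j - W 0)) :=
      ((tendsto_pi_nhds.1 hW) j).sub ((tendsto_pi_nhds.1 hW) 0)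
    have h2 : Tendsto (fun k => w (φ k) j - w (φ k) 0) atTop (𝓝 0) := by
      refine squeeze_zero_norm (a := fun k => (1 - a (φ k)) * K) (fun k => ?_) ?_
      · simp only [w, Pi.smul_apply, smul_eq_mul]
        have h3 : 0 ≤ 1 - a (φ k) := by linarith [ha1 (φ k)]
        rw [← mul_sub, norm_mul, Real.norm_of_nonneg h3]
        exact mul_le_mul_of_nonneg_left (hK _ _ _) h3
      · simpa using (hlim.comp hφ.tendsto_atTop).mul_const K
    linarith [tendsto_nhds_unique h1 h2]
  refine ⟨W 0, U + W, ?_⟩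
  have e : (fun j => (U + W) j - W 0) = U := by
    funext j
    rw [Pi.add_apply, hconst j, add_sub_cancel_right]
  rw [IsEigenpair, e, hfix]

theorem IsEigenpair.isTrajectory {L : MetroLine n} {h : ℝ} {v : ZMod n → ℝ}
    (hv : L.IsEigenpair h v) : L.IsTrajectory (fun k j => v j + k * h) := by
  intro k
  have e := L.f_add_const v (fun j => v j - h) ((k + 1 : ℕ) * h)
  rw [hv] at e
  refine e.symm.trans ?_
  congr 1
  funext j
  push_cast
  ring

theorem IsTrajectory.norm_sub_le [NeZero n] {L : MetroLine n} {ρ : ZMod n → ℕ}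
    (hρ : L.IsRank ρ) (hδ : ∀ j ∈ L.platform, 0 ≤ L.δ j ∧ L.δ j ≤ 1)
    {d e : ℕ → ZMod n → ℝ} (hd : L.IsTrajectory d) (he : L.IsTrajectory e) (k : ℕ) :
    ‖d k - e k‖ ≤ ‖d 0 - e 0‖ := by
  induction k with
  | zero => exact le_rfl
  | succ k ih => exact (L.norm_sub_le_of_eq_f hρ hδ (hd k) (he k)).trans ih

theorem IsTrajectory.hasGrowthVector [NeZero n] {L : MetroLine n} {ρ : ZMod n → ℕ}
    (hρ : L.IsRank ρ) (hδ : ∀ j ∈ L.platform, 0 ≤ L.δ j ∧ L.δ j ≤ 1) {h : ℝ}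
    {v : ZMod n → ℝ} (hv : L.IsEigenpair h v) {d : ℕ → ZMod n → ℝ} (hd : L.IsTrajectory d) :
    HasGrowthVector d (fun _ => h) := by
  have hinv : Tendsto (fun k : ℕ => ((k : ℝ))⁻¹) atTop (𝓝 0) :=
    tendsto_inv_atTop_nhds_zero_nat
  let e : ℕ → ZMod n → ℝ := fun k j => v j + k * h
  have h1 : Tendsto (fun k : ℕ => (k : ℝ)⁻¹ • (d k - e k)) atTop (𝓝 0) := by
    refine squeeze_zero_norm (a := fun k : ℕ => (k : ℝ)⁻¹ * ‖d 0 - e 0‖) (fun k => ?_) ?_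
    · rw [norm_smul, Real.norm_of_nonneg (by positivity)]
      exact mul_le_mul_of_nonneg_left (hd.norm_sub_le hρ hδ hv.isTrajectory k) (by positivity)
    · simpa using hinv.mul_const ‖d 0 - e 0‖
  have h2 : Tendsto (fun k : ℕ => (k : ℝ)⁻¹ • v + fun _ => h) atTop (𝓝 (fun _ => h)) := by
    simpa using (hinv.smul_const v).add_const (fun _ : ZMod n => h)
  have h3 := h1.add h2
  rw [zero_add] at h3
  refine h3.congr' ?_
  filter_upwards [eventually_gt_atTop 0] with k hk
  have hk' : (k : ℝ) ≠ 0 := by positivity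
  funext j
  simp only [e, Pi.add_apply, Pi.smul_apply, Pi.sub_apply, smul_eq_mul]
  field_simp
  ring

theorem existsUnique_isTrajectory [NeZero n] (L : MetroLine n) {ρ : ZMod n → ℕ}
    (hρ : L.IsRank ρ) (hδ : ∀ j ∈ L.platform, 0 ≤ L.δ j ∧ L.δ j ≤ 1) (d₀ : ZMod n → ℝ) :
    ∃! d : ℕ → ZMod n → ℝ, d 0 = d₀ ∧ L.IsTrajectory d := by
  choose g hg using L.exists_eq_f hρ
  refine ⟨fun k => g^[k] d₀, ⟨rfl, fun k => ?_⟩, fun d ⟨hd0, hd⟩ => funext fun k => ?_⟩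
  · simp only [Function.iterate_succ_apply']
    exact hg _
  · induction k with
    | zero => exact hd0
    | succ k ih =>
      rw [Function.iterate_succ_apply', ← ih]
      exact L.eq_of_eq_f hρ hδ (hd k) (hg _)

end MetroLine

theorem theorem6 (n : ℕ) [NeZero n] (L : MetroLine n)
    (hm : 0 < L.numTrains ∧ L.numTrains < n)
    (hδ : ∀ j ∈ L.platform, 0 ≤ L.δ j ∧ L.δ j ≤ 1) :
    (∀ d₀ : ZMod n → ℝ, ∃! d : ℕ → ZMod n → ℝ, d 0 = d₀ ∧ L.IsTrajectory d) ∧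
    ∃ h : ℝ,
      (∃ v : ZMod n → ℝ, L.IsEigenpair h v ∧ L.IsTrajectory (fun k j => v j + k * h)) ∧
      (∀ μ : ℝ, L.IsEigenvalue μ → μ = h) ∧
      (∀ d : ℕ → ZMod n → ℝ, L.IsTrajectory d → HasGrowthVector d (fun _ => h)) := by
  obtain ⟨h1, h0⟩ := L.exists_train_and_free hm
  obtain ⟨ρ, hρ⟩ := L.exists_isRank h1 h0
  obtain ⟨h, v, hv⟩ := L.exists_isEigenpair hρ hδ
  refine ⟨L.existsUnique_isTrajectory hρ hδ, h, ⟨v, hv, hv.isTrajectory⟩, ?_,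
    fun d hd => hd.hasGrowthVector hρ hδ hv⟩
  rintro μ ⟨w, hw⟩
  exact congrFun (tendsto_nhds_unique (hw.isTrajectory.hasGrowthVector hρ hδ hw)
    (hw.isTrajectory.hasGrowthVector hρ hδ hv)) 0
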